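/- Let $(R,\mathfrak m)$ be a noetherian (commutative) local ring and let $E$ be the injective hull of the residue field $k=R/\mathfrak m$. For an $R$-module $M$ let $M^\circ=\operatorname{Hom}_R(M,E)$ be its Matlis dual, and call $M$ (Matlis-)reflexive if the canonical map $\varphi\colon M\to M^{\circ\circ}$, $\varphi(m)(f)=f(m)$, is an isomorphism. For a prime ideal $\mathfrak p$ of $R$ with residue field $\kappa(\mathfrak p)=R_{\mathfrak p}/\mathfrak pR_{\mathfrak p}$ let $$\mu(\mathfrak p,M)=\dim_{\kappa(\mathfrak p)}\bigl(\operatorname{Hom}_R(R/\mathfrak p,M)_{\mathfrak p}\bigr),$$ a cardinal number, be the (zeroth) Bass number of $M$ with respect to $\mathfrak p$. Then for every $R$-module $M$: $M$ is reflexive if and only if $\mu(\mathfrak p,M)=\mu(\mathfrak p,M^{\circ\circ})$ for all prime ideals $\mathfrak p$ of $R$. -/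

import Mathlib

universe u v w

/-- `E` is an injective hull of the `R`-module `N`: it is an injective module that contains a copy
`ι(N)` of `N` as an essential submodule. (`R` and `E` live in the same universe, so that
`Module.Injective` is injectivity in the usual sense.) -/
def IsInjectiveHull (R : Type u) [CommRing R] (N : Type v) [AddCommGroup N] [Module R N]
    (E : Type u) [AddCommGroup E] [Module R E] : Prop :=
  Module.Injective R E ∧ ∃ ι : N →ₗ[R] E, Function.Injective ι ∧
    ∀ U : Submodule R E, U ⊓ LinearMap.range ι = ⊥ → U = ⊥

/-- The dual `M° = Hom_R(M, E)`; it is the Matlis dual when `R` is noetherian local and `E` is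
the injective hull of the residue field. -/
abbrev MatlisDual (R : Type u) [CommRing R] (E : Type w) [AddCommGroup E] [Module R E]
    (M : Type v) [AddCommGroup M] [Module R M] : Type (max v w) :=
  M →ₗ[R] E

/-- The canonical map `φ : M → M°°`, `φ(m)(f) = f(m)`. -/
def matlisEval (R : Type u) [CommRing R] (E : Type w) [AddCommGroup E] [Module R E]
    (M : Type v) [AddCommGroup M] [Module R M] :
    M →ₗ[R] MatlisDual R E (MatlisDual R E M) where
  toFun m :=
    { toFun := fun f => f m
      map_add' := fun _ _ => rfl
      map_smul' := fun _ _ => rfl }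
  map_add' m n := LinearMap.ext fun f => f.map_add m n
  map_smul' r m := LinearMap.ext fun f => f.map_smul r m

/-- `M` is (Matlis-)reflexive (with respect to `E`): the canonical map `M → M°°` is bijective. -/
def IsMatlisReflexive (R : Type u) [CommRing R] (E : Type w) [AddCommGroup E] [Module R E]
    (M : Type v) [AddCommGroup M] [Module R M] : Prop :=
  Function.Bijective (matlisEval R E M)

/-- The module `Hom_R(R/p, M)_p` over the local ring `R_p`. -/
abbrev LocalizedHom (R : Type u) [CommRing R] (p : Ideal R) [p.IsPrime]
    (M : Type v) [AddCommGroup M] [Module R M] : Type (max u v) :=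
  LocalizedModule p.primeCompl ((R ⧸ p) →ₗ[R] M)

/-- `Hom_R(R/p, M)_p` is annihilated by the maximal ideal of `R_p`. -/
theorem localizedHom_isTorsion (R : Type u) [CommRing R] (p : Ideal R) [p.IsPrime]
    (M : Type v) [AddCommGroup M] [Module R M] :
    Module.IsTorsionBySet (Localization.AtPrime p) (LocalizedHom R p M)
      (IsLocalRing.maximalIdeal (Localization.AtPrime p) : Set (Localization.AtPrime p)) := by
  rintro x ⟨a, ha⟩
  change a • x = 0
  rw [SetLike.mem_coe] at ha
  induction a using Localization.induction_on with
  | H y =>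
    obtain ⟨r, s⟩ := y
    rw [Localization.mk_eq_mk', IsLocalization.AtPrime.mk'_mem_maximal_iff _ p] at ha
    induction x using LocalizedModule.induction_on with
    | h f t =>
      rw [LocalizedModule.mk_smul_mk]
      have h0 : r • f = 0 := by
        ext
        have h1 : r • (1 : R ⧸ p) = 0 := by
          rw [Algebra.smul_def, mul_one]
          exact Ideal.Quotient.eq_zero_iff_mem.mpr ha
        change r • f (Ideal.Quotient.mk p 1) = 0
        rw [map_one, ← map_smul, h1, map_zero]
      rw [h0, LocalizedModule.zero_mk]

/-- The vector space structure on `Hom_R(R/p, M)_p` over `κ(p) = R_p / p R_p` induced by its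
`R_p`-module structure. -/
noncomputable instance localizedHomModule (R : Type u) [CommRing R] (p : Ideal R) [p.IsPrime]
    (M : Type v) [AddCommGroup M] [Module R M] :
    Module p.ResidueField (LocalizedHom R p M) :=
  (localizedHom_isTorsion R p M).module

/-- The (zeroth) Bass number `μ(p, M) = dim_{κ(p)} (Hom_R(R/p, M)_p)`, a cardinal number. -/
noncomputable def bassNumber (R : Type u) [CommRing R] (p : Ideal R) [p.IsPrime]
    (M : Type v) [AddCommGroup M] [Module R M] : Cardinal.{max u v} :=
  Module.rank p.ResidueField (LocalizedHom R p M)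

/-!
Since `E` is an injective cogenerator, `φ : M → M°°` is injective and pure. Let `C` be its cokernel.

Purity makes `0 → Hom(R/p, M) → Hom(R/p, M°°) → Hom(R/p, C) → 0` exact, so that
`μ(p, M°°) = μ(p, M) + μ(p, C)` for every prime `p`. If `φ` is not surjective, some `p` is
associated to `C`, that is `μ(p, C) ≥ 1`; equal Bass numbers then force `μ(p, M)` to be infinite.
But when `μ(p, M)` is infinite, `M°°` has a Bass number at `p` of at least `2 ^ μ(p, M)`, which is a
contradiction.

All this is phrased with families of elements that are killed by `p` and independent over `R ⧸ p`
(`LinearIndependentModulo`): the Bass number is the largest cardinality of such a family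
(`LinearIndependentModulo.mk_le_bassNumber`, `exists_linearIndependentModulo_mk_eq_bassNumber`).
Purity enters as `IsInjectiveHull.exists_smul_sub_matlisEval_eq_zero`, which lifts an element of `C`
with annihilator `p` to an element of `M°°` killed by `p`; adjoining the lift to the image of a
maximal family of `M` enlarges it. The growth in the infinite case is
`IsInjectiveHull.exists_linearIndependentModulo_bidual`: the eventual value of functions on the
directed set of finite subsets of `I` extends to a linear functional on all functions with values in
`E`, and restricting along `s ↦ s ∩ B` gives one element of the bidual for each subset `B` of `I`.
-/

/-! ### Linear independence modulo an ideal -/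

/-- A family `x` in an `R`-module is linearly independent modulo the ideal `p` if it is annihilated
by `p` and linearly independent over `R ⧸ p`, i.e. if the coefficient tuples of its linear relations
are exactly those with all entries in `p`. -/
def LinearIndependentModulo {R : Type u} [CommRing R] (p : Ideal R) {M : Type v} [AddCommGroup M]
    [Module R M] {I : Type w} (x : I → M) : Prop :=
  ∀ l : I →₀ R, Finsupp.linearCombination R x l = 0 ↔ ∀ i, l i ∈ p

namespace LinearIndependentModulo

variable {R : Type u} [CommRing R] {p : Ideal R} {M : Type v} [AddCommGroup M] [Module R M]
  {I : Type w} {x : I → M}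

theorem smul_eq_zero (hx : LinearIndependentModulo p x) {a : R} (ha : a ∈ p) (i : I) :
    a • x i = 0 := by
  classical
  rw [← Finsupp.linearCombination_single, hx]
  intro j
  rw [Finsupp.single_apply]
  split_ifs
  exacts [ha, p.zero_mem]

theorem of_annihilated (h : ∀ a ∈ p, ∀ i, a • x i = 0)
    (h' : ∀ l : I →₀ R, Finsupp.linearCombination R x l = 0 → ∀ i, l i ∈ p) :
    LinearIndependentModulo p x := fun l => by
  refine ⟨h' l, fun hl => ?_⟩
  rw [Finsupp.linearCombination_apply]
  exact Finset.sum_eq_zero fun i _ => h _ (hl i) i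

theorem comp_injective (hx : LinearIndependentModulo p x) {J : Type*} {g : J → I}
    (hg : Function.Injective g) : LinearIndependentModulo p (x ∘ g) := by
  refine of_annihilated (fun a ha i => hx.smul_eq_zero ha (g i)) fun l hl i => ?_
  rw [← Finsupp.linearCombination_mapDomain, hx] at hl
  simpa [Finsupp.mapDomain_apply hg] using hl (g i)

theorem map {N : Type*} [AddCommGroup N] [Module R N] (hx : LinearIndependentModulo p x)
    {f : M →ₗ[R] N} (hf : Function.Injective f) : LinearIndependentModulo p (f ∘ x) := fun l => by
  rw [← hx l, ← Finsupp.apply_linearCombination, map_eq_zero_iff f hf]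

end LinearIndependentModulo

/-! ### Bass numbers and independent families -/

section BassNumber

variable {R : Type u} [CommRing R] (p : Ideal R) [p.IsPrime] {M : Type v} [AddCommGroup M]
  [Module R M]

theorem algebraMap_smul_localizedHom (r : R) (z : LocalizedHom R p M) :
    algebraMap R p.ResidueField r • z = r • z := by
  rw [IsScalarTower.algebraMap_apply R (Localization.AtPrime p) p.ResidueField]
  change (algebraMap R (Localization.AtPrime p) r) • z = r • z
  rw [algebraMap_smul]

/-- Independence modulo a prime `p` is independence over `κ(p)` after localization at `p`, because
`κ(p)` is the field of fractions of `R ⧸ p`. -/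
theorem linearIndependentModulo_iff_linearIndependent {I : Type w} (f : I → (R ⧸ p) →ₗ[R] M) :
    LinearIndependentModulo p (fun i => f i 1) ↔
      LinearIndependent p.ResidueField
        (fun i => (LocalizedModule.mk (f i) 1 : LocalizedHom R p M)) := by
  let _ : Module (R ⧸ p) (LocalizedHom R p M) :=
    Module.compHom _ (algebraMap (R ⧸ p) p.ResidueField)
  have : IsScalarTower (R ⧸ p) p.ResidueField (LocalizedHom R p M) :=
    ⟨fun a b c => by rw [Algebra.smul_def, mul_smul]; rfl⟩
  have hsmul (r : R) (z : LocalizedHom R p M) : Ideal.Quotient.mk p r • z = r • z :=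
    algebraMap_smul_localizedHom p r z
  have hone (l : I →₀ R) : Finsupp.linearCombination R (fun i => f i 1) l
      = Finsupp.linearCombination R f l 1 := by
    simp [Finsupp.linearCombination_apply, Finsupp.sum, LinearMap.sum_apply]
  have hzero (g : (R ⧸ p) →ₗ[R] M) : g 1 = 0 ↔ g = 0 := by
    refine ⟨fun h => ?_, fun h => by rw [h]; rfl⟩
    ext
    exact h
  have hmk (l : I →₀ R) :
      Finsupp.linearCombination (R ⧸ p) (fun i => (LocalizedModule.mk (f i) 1 : LocalizedHom R p M))
        (l.mapRange (Ideal.Quotient.mk p) (map_zero _))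
      = LocalizedModule.mkLinearMap p.primeCompl _ (Finsupp.linearCombination R f l) := by
    rw [Finsupp.apply_linearCombination, Finsupp.linearCombination_apply,
      Finsupp.linearCombination_apply]
    refine (Finsupp.sum_mapRange_index fun i =>
      zero_smul (R ⧸ p) (LocalizedModule.mk (f i) 1 : LocalizedHom R p M)).trans ?_
    exact Finsupp.sum_congr fun i _ => hsmul _ _
  rw [← LinearIndependent.iff_fractionRing (R ⧸ p) p.ResidueField, linearIndependent_iff]
  constructor
  · intro h l hl
    obtain ⟨l, rfl⟩ := Finsupp.mapRange_surjective _ (map_zero (Ideal.Quotient.mk p))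
      Ideal.Quotient.mk_surjective l
    rw [hmk, IsLocalizedModule.eq_zero_iff p.primeCompl] at hl
    obtain ⟨s, hs⟩ := hl
    have hs' := (h ((s : R) • l)).1 (by rw [hone, map_smul, hzero]; exact hs)
    ext i
    rw [Finsupp.mapRange_apply, Finsupp.zero_apply, Ideal.Quotient.eq_zero_iff_mem]
    exact (‹p.IsPrime›.mem_or_mem (hs' i)).resolve_left s.2
  · intro h
    refine .of_annihilated (fun a ha i => ?_) fun l hl i => ?_
    · rw [← map_smul, Algebra.smul_def, mul_one]
      exact (congrArg (f i) (Ideal.Quotient.eq_zero_iff_mem.2 ha)).trans (map_zero _)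
    · have := h _ ((hmk l).trans (by rw [(hzero _).1 ((hone l).symm.trans hl), map_zero]))
      simpa [Ideal.Quotient.eq_zero_iff_mem] using DFunLike.congr_fun this i

theorem LinearIndependentModulo.mk_le_bassNumber {I : Type (max u v)} {x : I → M}
    (hx : LinearIndependentModulo p x) : Cardinal.mk I ≤ bassNumber R p M := by
  let f (i : I) : (R ⧸ p) →ₗ[R] M :=
    p.liftQ (LinearMap.toSpanSingleton R M (x i)) fun a ha => hx.smul_eq_zero ha i
  have hf (i : I) : f i 1 = x i := one_smul R (x i)
  exact ((linearIndependentModulo_iff_linearIndependent p f).1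
    (by simpa only [hf] using hx)).cardinal_le_rank

theorem exists_linearIndependentModulo_mk_eq_bassNumber (M : Type v) [AddCommGroup M]
    [Module R M] : ∃ (I : Type (max u v)) (x : I → M),
      LinearIndependentModulo p x ∧ Cardinal.mk I = bassNumber R p M := by
  let b := Module.Basis.ofVectorSpace p.ResidueField (LocalizedHom R p M)
  have hb (i) : ∃ (f : (R ⧸ p) →ₗ[R] M) (s : p.primeCompl),
      (s : R) • b i = LocalizedModule.mk f 1 := by
    induction h : b i using LocalizedModule.induction_on with
    | h f s => exact ⟨f, s, by
        rw [LocalizedModule.smul'_mk]; exact LocalizedModule.mk_cancel s f⟩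
  -- Clearing the denominators `s i` rescales the basis vectors by nonzero elements of `κ(p)`.
  choose f s hf using hb
  have hs (i) : algebraMap R p.ResidueField (s i) ≠ 0 := fun h =>
    (s i).2 (by rwa [Ideal.algebraMap_residueField_eq_zero] at h)
  refine ⟨_, fun i => f i 1, (linearIndependentModulo_iff_linearIndependent p f).2 ?_, b.mk_eq_rank''⟩
  have h : (fun i => LocalizedModule.mk (f i) 1) =
      (fun i => Units.mk0 _ (hs i)) • (b : _ → LocalizedHom R p M) := funext fun i => by
    rw [← hf, ← algebraMap_smul_localizedHom]
    rfl
  rw [h]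
  exact b.linearIndependent.units_smul _

end BassNumber

/-! ### Extending functionals into the injective hull -/

section InjectiveCogenerator

variable {R : Type u} [CommRing R] {E : Type u} [AddCommGroup E] [Module R E]

/-- The eventual value along a filter of an eventually constant function is linear in the function,
so it extends to all functions with values in an injective module. -/
theorem Module.Injective.exists_extend_const (hE : Module.Injective R E) {ι : Type*}
    (ℓ : Filter ι) [ℓ.NeBot] :
    ∃ L : (ι → E) →ₗ[R] E, ∀ (g : ι → E) (y : E), (∀ᶠ i in ℓ, g i = y) → L g = y := by
  let Z : Submodule R (ι → E) :=
    { carrier := {g | ∀ᶠ i in ℓ, g i = 0}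
      add_mem' := fun ha hb => by filter_upwards [ha, hb] with i h h'; simp [h, h']
      zero_mem' := by simp
      smul_mem' := fun c g hg => by filter_upwards [hg] with i h; simp [h] }
  -- Constant functions embed `E` into the functions modulo those that vanish eventually.
  let c : E →ₗ[R] (ι → E) ⧸ Z := Z.mkQ ∘ₗ LinearMap.pi fun _ => LinearMap.id
  have hc : Function.Injective c := by
    rw [← LinearMap.ker_eq_bot, LinearMap.ker_eq_bot']
    intro y hy
    have : ∀ᶠ _ in ℓ, y = 0 := (Submodule.Quotient.mk_eq_zero Z).1 hy
    simpa using this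
  obtain ⟨h, hh⟩ := (Module.Baer.of_injective hE).extension_property c hc LinearMap.id
  refine ⟨h ∘ₗ Z.mkQ, fun g y hg => ?_⟩
  have hgy : Z.mkQ g = c y := (Submodule.Quotient.eq Z).2 <| by
    change ∀ᶠ i in ℓ, g i - y = 0
    simpa only [sub_eq_zero] using hg
  rw [LinearMap.comp_apply, hgy]
  exact LinearMap.congr_fun hh y

theorem LinearIndependentModulo.exists_extend (hE : Module.Injective R E) {p : Ideal R}
    {M : Type v} [AddCommGroup M] [Module R M] {I : Type w} {x : I → M}
    (hx : LinearIndependentModulo p x) (g : I → E) (hg : ∀ a ∈ p, ∀ i, a • g i = 0) :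
    ∃ f : M →ₗ[R] E, ∀ i, f (x i) = g i := by
  let c := Finsupp.linearCombination R x
  have hker : LinearMap.ker c ≤ LinearMap.ker (Finsupp.linearCombination R g) := fun l hl => by
    rw [LinearMap.mem_ker, Finsupp.linearCombination_apply]
    exact Finset.sum_eq_zero fun i _ => hg _ ((hx l).1 hl i) i
  obtain ⟨f, hf⟩ := (Module.Baer.of_injective hE).extension_property
    ((LinearMap.ker c).liftQ c le_rfl)
    (LinearMap.ker_eq_bot.1 (Submodule.ker_liftQ_eq_bot _ _ _ le_rfl))
    ((LinearMap.ker c).liftQ _ hker)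
  refine ⟨f, fun i => ?_⟩
  simpa [c] using LinearMap.congr_fun hf (Submodule.Quotient.mk (Finsupp.single i 1))

namespace IsInjectiveHull

variable [IsLocalRing R]

/-- The injective hull of the residue field of a local ring is a cogenerator. -/
theorem exists_dual_ne_zero (hE : IsInjectiveHull R (IsLocalRing.ResidueField R) E)
    {X : Type v} [AddCommGroup X] [Module R X] {x : X} (hx : x ≠ 0) :
    ∃ f : X →ₗ[R] E, f x ≠ 0 := by
  obtain ⟨hE, ι, hι, -⟩ := hE
  let c := LinearMap.toSpanSingleton R X x
  have hker : LinearMap.ker c ≤ LinearMap.ker (Algebra.linearMap R (IsLocalRing.ResidueField R)) :=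
    fun a ha => (IsLocalRing.residue_eq_zero_iff a).2 <|
      IsLocalRing.le_maximalIdeal (J := LinearMap.ker c)
        (fun h => hx (by simpa [c] using h.ge (Submodule.mem_top (x := (1 : R))))) ha
  obtain ⟨f, hf⟩ := (Module.Baer.of_injective hE).extension_property
    ((LinearMap.ker c).liftQ c le_rfl)
    (LinearMap.ker_eq_bot.1 (Submodule.ker_liftQ_eq_bot _ _ _ le_rfl))
    (ι ∘ₗ (LinearMap.ker c).liftQ _ hker)
  have h : f (c 1) = ι (algebraMap R _ 1) := LinearMap.congr_fun hf (Submodule.Quotient.mk 1)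
  have hc : c 1 = x := one_smul R x
  refine ⟨f, ?_⟩
  rw [← hc, h, map_one, Ne, map_eq_zero_iff ι hι]
  exact one_ne_zero

theorem exists_dual_eq_zero_ne_zero (hE : IsInjectiveHull R (IsLocalRing.ResidueField R) E)
    {X : Type v} [AddCommGroup X] [Module R X] {U : Submodule R X} {x : X} (hx : x ∉ U) :
    ∃ f : X →ₗ[R] E, (∀ u ∈ U, f u = 0) ∧ f x ≠ 0 := by
  obtain ⟨f, hf⟩ := hE.exists_dual_ne_zero (x := U.mkQ x)
    (fun h => hx ((Submodule.Quotient.mk_eq_zero U).1 h))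
  exact ⟨f ∘ₗ U.mkQ, fun u hu => by simp [(Submodule.Quotient.mk_eq_zero U).2 hu], hf⟩

theorem exists_smul_ne_zero (hE : IsInjectiveHull R (IsLocalRing.ResidueField R) E)
    {p : Ideal R} {r : R} (hr : r ∉ p) : ∃ y : E, (∀ a ∈ p, a • y = 0) ∧ r • y ≠ 0 := by
  obtain ⟨f, hf, hfr⟩ := hE.exists_dual_eq_zero_ne_zero hr
  have h (a : R) : a • f 1 = f a := by rw [← map_smul, smul_eq_mul, mul_one]
  exact ⟨f 1, fun a ha => by rw [h, hf a ha], by rwa [h]⟩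

/-! ### The map to the bidual -/

variable {M : Type v} [AddCommGroup M] [Module R M]

theorem matlisEval_injective (hE : IsInjectiveHull R (IsLocalRing.ResidueField R) E) :
    Function.Injective (matlisEval R E M) := by
  rw [← LinearMap.ker_eq_bot, LinearMap.ker_eq_bot']
  intro m hm
  by_contra h
  obtain ⟨f, hf⟩ := hE.exists_dual_ne_zero h
  exact hf (LinearMap.congr_fun hm f)

/-- A consequence of the purity of `M → M°°`: an element of `M°°` that a finitely generated ideal
multiplies into `M` is congruent modulo `M` to an element annihilated by that ideal. -/
theorem exists_smul_sub_matlisEval_eq_zero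
    (hE : IsInjectiveHull R (IsLocalRing.ResidueField R) E) {p : Ideal R} (hp : p.FG)
    {x : MatlisDual R E (MatlisDual R E M)}
    (hx : ∀ a ∈ p, a • x ∈ LinearMap.range (matlisEval R E M)) :
    ∃ m : M, ∀ a ∈ p, a • (x - matlisEval R E M m) = 0 := by
  classical
  obtain ⟨s, rfl⟩ := hp
  choose m hm using fun a : s => hx a (Submodule.subset_span a.2)
  let T : M →ₗ[R] (s → M) := LinearMap.pi fun a => (a : R) • LinearMap.id
  have hmT : m ∈ LinearMap.range T := by
    by_contra h
    obtain ⟨f, hf, hfm⟩ := hE.exists_dual_eq_zero_ne_zero h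
    -- The components of `f` are functionals `g a` on `M` with `∑ a • g a = 0`.
    let g (a : s) : MatlisDual R E M := f ∘ₗ LinearMap.single R (fun _ => M) a
    have hfg (y : s → M) : f y = ∑ a, g a (y a) := by
      conv_lhs => rw [← Finset.univ_sum_single y, map_sum]
      rfl
    have hg : ∑ a : s, (a : R) • g a = 0 := by
      ext y
      rw [LinearMap.sum_apply, LinearMap.zero_apply, ← hf (T y) ⟨y, rfl⟩, hfg]
      exact Finset.sum_congr rfl fun a _ => ((g a).map_smul a y).symm
    refine hfm ?_
    calc f m = ∑ a, matlisEval R E M (m a) (g a) := hfg m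
      _ = ∑ a : s, x ((a : R) • g a) := Finset.sum_congr rfl fun a _ => by
        rw [hm, LinearMap.smul_apply, map_smul]
      _ = 0 := by rw [← map_sum, hg, map_zero]
  obtain ⟨y, hy⟩ := hmT
  refine ⟨y, fun a ha => ?_⟩
  have hle : Submodule.span R (s : Set R) ≤
      LinearMap.ker (LinearMap.toSpanSingleton R _ (x - matlisEval R E M y)) := by
    refine Submodule.span_le.2 fun b hb => ?_
    have hb' : b • y = m ⟨b, hb⟩ := congrFun hy ⟨b, hb⟩
    rw [SetLike.mem_coe, LinearMap.mem_ker, LinearMap.toSpanSingleton_apply, smul_sub, ← map_smul,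
      hb', hm, sub_self]
  exact hle ha

/-- From a family indexed by the finite subsets of `I` one gets a family in the bidual indexed by
all subsets of `I`: the element attached to `B` sends a functional `f` to the "limit", along the
finite subsets `s` of `I`, of the values of `f` at the members `s ∩ B` of the given family. -/
theorem exists_linearIndependentModulo_bidual
    (hE : IsInjectiveHull R (IsLocalRing.ResidueField R) E) {p : Ideal R} {I : Type w}
    {x : Finset I → M} (hx : LinearIndependentModulo p x) :
    ∃ X : Set I → MatlisDual R E (MatlisDual R E M), LinearIndependentModulo p X := by
  classical
  obtain ⟨L, hL⟩ := hE.1.exists_extend_const (Filter.atTop : Filter (Finset I))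
  let X (B : Set I) : MatlisDual R E (MatlisDual R E M) :=
    L ∘ₗ LinearMap.pi fun s => matlisEval R E M (x (s.filter (· ∈ B)))
  have hX (B : Set I) (f : M →ₗ[R] E) : X B f = L fun s => f (x (s.filter (· ∈ B))) := rfl
  refine ⟨X, .of_annihilated (fun a ha B => ?_) fun l hl B₀ => ?_⟩
  · ext f
    rw [LinearMap.smul_apply, hX, ← map_smul]
    refine hL _ 0 (.of_forall fun s => ?_)
    rw [Pi.smul_apply, ← map_smul, hx.smul_eq_zero ha, map_zero]
  · by_contra hB₀
    obtain ⟨y, hy, hy'⟩ := hE.exists_smul_ne_zero hB₀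
    -- A finite set `F` that separates `B₀` from the other subsets in the support of `l`.
    obtain ⟨F, hF⟩ : ∃ F : Finset I, ∀ B ∈ l.support, (∀ i ∈ F, i ∈ B ↔ i ∈ B₀) → B = B₀ := by
      have (B : Set I) : ∃ F : Finset I, (∀ i ∈ F, i ∈ B ↔ i ∈ B₀) → B = B₀ := by
        by_cases h : B = B₀
        · exact ⟨∅, fun _ => h⟩
        · obtain ⟨i, hi⟩ := not_forall.1 (mt Set.ext h)
          exact ⟨{i}, fun h => (hi (h i (Finset.mem_singleton_self i))).elim⟩
      choose F hF using this
      exact ⟨l.support.biUnion F, fun B hB h =>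
        hF B fun i hi => h i (Finset.mem_biUnion.2 ⟨B, hB, hi⟩)⟩
    -- The functional `f` takes the value `y` at the members of the family whose index agrees with
    -- `B₀` on `F`, and vanishes at the others.
    obtain ⟨f, hf⟩ := hx.exists_extend hE.1
      (fun t => if ∀ i ∈ F, i ∈ t ↔ i ∈ B₀ then y else 0)
      (fun a ha t => by split_ifs; exacts [hy a ha, smul_zero a])
    have hXf (B : Set I) : X B f = if ∀ i ∈ F, i ∈ B ↔ i ∈ B₀ then y else 0 := by
      rw [hX]
      refine hL _ _ ?_
      filter_upwards [Filter.eventually_ge_atTop F] with s hs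
      rw [hf]
      refine if_congr (forall₂_congr fun i hi => ?_) rfl rfl
      simp [hs hi]
    have hB₀' : B₀ ∈ l.support := Finsupp.mem_support_iff.2 fun h => hB₀ (h ▸ p.zero_mem)
    refine hy' ?_
    calc l B₀ • y = ∑ B ∈ l.support, l B • X B f := by
          rw [Finset.sum_eq_single_of_mem B₀ hB₀' fun B hB hne => ?_, hXf, if_pos fun _ _ => .rfl]
          rw [hXf, if_neg fun h => hne (hF B hB h), smul_zero]
      _ = Finsupp.linearCombination R X l f := by
          rw [Finsupp.linearCombination_apply, Finsupp.sum, LinearMap.sum_apply]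
          rfl
      _ = 0 := by rw [hl, LinearMap.zero_apply]

end IsInjectiveHull

end InjectiveCogenerator

/-- A family in a submodule `U` stays independent modulo `p` when an element is adjoined whose class
modulo `U` has annihilator `p`. -/
theorem LinearIndependentModulo.option {R : Type u} [CommRing R] {p : Ideal R} {M : Type v}
    [AddCommGroup M] [Module R M] {I : Type w} {x : I → M} (hx : LinearIndependentModulo p x)
    {U : Submodule R M} (hU : ∀ i, x i ∈ U) {y : M} (hy : ∀ a ∈ p, a • y = 0)
    (hyU : ∀ a, a • y ∈ U → a ∈ p) :
    LinearIndependentModulo p (fun o : Option I => o.elim y x) := by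
  refine .of_annihilated (fun a ha o => ?_) fun l hl => ?_
  · cases o with
    | none => exact hy a ha
    | some i => exact hx.smul_eq_zero ha i
  · have hsum : l none • y + Finsupp.linearCombination R x l.some = 0 := by
      rw [← hl, Finsupp.linearCombination_option]
      rfl
    have hnone : l none ∈ p := hyU _ <| by
      rw [eq_neg_of_add_eq_zero_left hsum, Finsupp.linearCombination_apply]
      exact U.neg_mem (U.sum_mem fun i _ => U.smul_mem _ (hU i))
    rw [hy _ hnone, zero_add, hx] at hsum
    rintro (_ | i)
    exacts [hnone, hsum i]

/-! ### Reflexivity and Bass numbers -/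

theorem mainTheorem2 {R : Type u} [CommRing R] [IsLocalRing R] [IsNoetherianRing R]
    {E : Type u} [AddCommGroup E] [Module R E]
    (hE : IsInjectiveHull R (IsLocalRing.ResidueField R) E)
    (M : Type v) [AddCommGroup M] [Module R M] :
    IsMatlisReflexive R E M ↔
      ∀ (p : Ideal R) [p.IsPrime],
        bassNumber R p M = bassNumber R p (MatlisDual R E (MatlisDual R E M)) := by
  constructor
  · intro h p _
    let e := LinearEquiv.ofBijective (matlisEval R E M) h
    apply le_antisymm
    · obtain ⟨I, x, hx, hI⟩ := exists_linearIndependentModulo_mk_eq_bassNumber p M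
      exact hI ▸ (hx.map e.injective).mk_le_bassNumber p
    · obtain ⟨I, x, hx, hI⟩ := exists_linearIndependentModulo_mk_eq_bassNumber p
        (MatlisDual R E (MatlisDual R E M))
      exact hI ▸ (hx.map (f := e.symm.toLinearMap) e.symm.injective).mk_le_bassNumber p
  · intro h
    refine ⟨hE.matlisEval_injective, LinearMap.range_eq_top.1 ?_⟩
    by_contra hne
    set U := LinearMap.range (matlisEval R E M)
    have := Submodule.Quotient.nontrivial_iff.2 hne
    obtain ⟨p, hp⟩ := associatedPrimes.nonempty R (_ ⧸ U)
    obtain ⟨hp, z, hz⟩ := isAssociatedPrime_iff.1 hp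
    obtain ⟨x, rfl⟩ := U.mkQ_surjective z
    have hxp (a : R) : a ∈ p ↔ a • x ∈ U := by
      rw [hz, Submodule.mem_colon_singleton, Submodule.mem_bot, ← map_smul]
      exact Submodule.Quotient.mk_eq_zero U
    obtain ⟨m, hm⟩ := hE.exists_smul_sub_matlisEval_eq_zero (IsNoetherian.noetherian p)
      fun a ha => (hxp a).1 ha
    obtain ⟨I, e, he, hI⟩ := exists_linearIndependentModulo_mk_eq_bassNumber p M
    rw [h p] at hI
    rcases finite_or_infinite I with hfin | hinf
    · -- The images of a maximal family stay independent when `x - φ(m)` is adjoined.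
      have hopt := ((he.map hE.matlisEval_injective).option (U := U) (fun i => ⟨_, rfl⟩) hm
        fun a ha => (hxp a).2 ?_).mk_le_bassNumber p
      · rw [Cardinal.mk_option, ← hI] at hopt
        obtain ⟨n, hn⟩ := Cardinal.lt_aleph0.1 (Cardinal.mk_lt_aleph0_iff.2 hfin)
        rw [hn] at hopt
        exact absurd (by exact_mod_cast hopt : n + 1 ≤ n) (Nat.not_succ_le_self n)
      · have := U.add_mem ha (U.smul_mem a ⟨m, rfl⟩)
        rwa [smul_sub, sub_add_cancel] at this
    · -- Here the bidual contains an independent family of cardinality `2 ^ μ(p, M)`.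
      obtain ⟨σ⟩ := Cardinal.eq.1 (Cardinal.mk_finset_of_infinite I)
      obtain ⟨X, hX⟩ := hE.exists_linearIndependentModulo_bidual (he.comp_injective σ.injective)
      have hle := hX.mk_le_bassNumber p
      rw [Cardinal.mk_set, ← hI] at hle
      exact (Cardinal.cantor _).not_ge hle
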